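/- Let $m<D$ and let $\mathbf X\in\mathbb R^{D\times N}$ have the singular-value decomposition $\mathbf X=\mathbf U\boldsymbol\Sigma\mathbf V^T$, where $\mathbf U\in\mathbb R^{D\times m}$ and $\mathbf V\in\mathbb R^{N\times m}$ have orthonormal columns and $\boldsymbol\Sigma=\mathrm{diag}(\lambda_1,\dots,\lambda_m)$ with $\lambda_1\ge\dots\ge\lambda_m>0$. Let $\mathbf U_\perp\in\mathbb R^{D\times(D-m)}$ have orthonormal columns orthogonal to those of $\mathbf U$. Let $\mathbf W$ be a random $D\times N$ matrix with i.i.d. entries $W_{ij}\sim\mathcal N(0,1/D)$, and for $\epsilon_X\in\mathbb R$ put $\tilde{\mathbf X}=\mathbf X+\epsilon_X\mathbf W$. Then, on the same probability space, there is a random matrix $\mathbf W_0\in\mathbb R^{(D-m)\times m}$, not depending on $\epsilon_X$, with i.i.d. entries distributed as $\mathcal N(0,1/D)$, such that for every realization of the noise the following holds. For all $\epsilon_X$ sufficiently close to $0$, the top-$m$ left singular subspace of $\tilde{\mathbf X}$ (the span of its first $m$ left singular vectors, singular values being ordered decreasingly) is uniquely determined, and it has a basis matrix $\tilde{\mathbf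 U}=\tilde{\mathbf U}(\epsilon_X)\in\mathbb R^{D\times m}$ with $\tilde{\mathbf U}^T\tilde{\mathbf U}=\mathbf I_m$ such that $$\tilde{\mathbf U}=\mathbf U+\epsilon_X\,\mathbf U_\perp\mathbf W_0\boldsymbol\Sigma^{-1}+O(\epsilon_X^2)\qquad(\epsilon_X\to0).$$ The threshold on $\epsilon_X$ and the constant in $O(\cdot)$ may depend on the realization of the noise. -/

import Mathlib

open MeasureTheory ProbabilityTheory Filter Topology Asymptotics
open scoped NNReal Matrix

/-- The `D × N` rectangular diagonal matrix with diagonal entries `s 0, s 1, …`. -/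
def rectDiag (D N : ℕ) (s : ℕ → ℝ) : Matrix (Fin D) (Fin N) ℝ :=
  Matrix.of fun i j => if (i : ℕ) = (j : ℕ) then s i else 0

/-- `A = P S Rᵀ` is a (full) singular-value decomposition: `P` and `R` are square orthogonal
matrices and `S` is rectangular diagonal, with nonnegative diagonal entries in descending order. -/
structure IsSVD {D N : ℕ} (A : Matrix (Fin D) (Fin N) ℝ) (P : Matrix (Fin D) (Fin D) ℝ)
    (s : ℕ → ℝ) (R : Matrix (Fin N) (Fin N) ℝ) : Prop where
  left_orthogonal : P ∈ Matrix.orthogonalGroup (Fin D) ℝ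
  right_orthogonal : R ∈ Matrix.orthogonalGroup (Fin N) ℝ
  nonneg : ∀ k, 0 ≤ s k
  antitone : Antitone s
  eq_mul : A = P * rectDiag D N s * Rᵀ

/-- `X = U Σ Vᵀ` is a compact singular-value decomposition: `U` and `V` have `m` orthonormal
columns and `Σ` is the `m × m` diagonal matrix of the positive singular values `lam`, in
descending order. In particular `X` has rank `m`. -/
structure IsCompactSVD {D N m : ℕ} (X : Matrix (Fin D) (Fin N) ℝ) (U : Matrix (Fin D) (Fin m) ℝ)
    (lam : Fin m → ℝ) (V : Matrix (Fin N) (Fin m) ℝ) : Prop where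
  left_orthonormal : Uᵀ * U = 1
  right_orthonormal : Vᵀ * V = 1
  pos : ∀ k, 0 < lam k
  antitone : Antitone lam
  eq_mul : X = U * Matrix.diagonal lam * Vᵀ

/-- The columns of `Uperp` form an orthonormal basis of the orthogonal complement of the column
space of `U` (the null space of `Uᵀ`), where `U` has `m` orthonormal columns. -/
structure IsOrthonormalComplement {D m : ℕ} (U : Matrix (Fin D) (Fin m) ℝ)
    (Uperp : Matrix (Fin D) (Fin (D - m)) ℝ) : Prop where
  orthonormal : Uperpᵀ * Uperp = 1
  orthogonal : Uᵀ * Uperp = 0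

/-- `S` is a top-`m` left singular subspace of `A`: the span of the first `m` left singular
vectors in some singular-value decomposition of `A`. -/
def IsTopLeftSingularSubspace {D N : ℕ} (m : ℕ) (A : Matrix (Fin D) (Fin N) ℝ)
    (S : Submodule ℝ (Fin D → ℝ)) : Prop :=
  ∃ P s R, IsSVD A P s R ∧ S = Submodule.span ℝ (P.col '' {k : Fin D | (k : ℕ) < m})

/-- The subspace `span(U) = {U v}` represented by a basis matrix `U`. -/
noncomputable def colSpan {D m : ℕ} (U : Matrix (Fin D) (Fin m) ℝ) :
    Submodule ℝ (Fin D → ℝ) :=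
  LinearMap.range U.mulVecLin

/-- `W` is a random matrix with independent `N(0, v)` entries. -/
structure IsGaussianMatrix {Ω : Type*} [MeasurableSpace Ω] {p q : ℕ}
    (W : Ω → Matrix (Fin p) (Fin q) ℝ) (v : ℝ≥0) (μ : Measure Ω) : Prop where
  law : ∀ i j, HasLaw (fun ω => W ω i j) (gaussianReal 0 v) μ
  indep : iIndepFun (fun (k : Fin p × Fin q) ω => W ω k.1 k.2) μ

/-!
The random matrix is `W₀ = Uperpᵀ W V`. Its entries are linear in those of `W`, hence jointly
Gaussian, and orthonormality of the columns of `Uperp` and `V` makes them uncorrelated with the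
original variance, so they are independent (`IsGaussianMatrix.transpose_mul_mul`).

The rest is deterministic. Write `A = X + ε W`. Two dimension counts bound its singular values: the
first `m` stay away from `0` (`IsCompactSVD.sq_le_of_isSVD_add`), the others are `O(ε)`
(`IsCompactSVD.isSVD_add_sq_le`). This gap makes the top-`m` left singular subspace independent of
the decomposition, because eigenvectors of `A Aᵀ` for distinct eigenvalues are orthogonal
(`IsSVD.span_le_span`); a decomposition exists by `exists_isSVD`.

For the expansion, let `P₁`, `R₁` be the leading singular vectors of `A` and `S₁` the diagonal matrix
of its leading singular values. Since `P₁ = A R₁ S₁⁻¹` and `Uperpᵀ X = 0`, the matrix `Uperpᵀ P₁` is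
`O(ε)`, hence `Uᵀ P₁` is orthogonal up to `O(ε ^ 2)`. Rotating `P₁` by the transpose of the
orthogonal polar factor of `Uᵀ P₁` gives a frame `Ut` of the same subspace with `Uᵀ Ut = 1 + O(ε ^ 2)`
(`IsBigOPow.one_sub_mul_polar`). Finally `Ut = A Z` with `Z` bounded, and `Z = V Σ⁻¹ + O(ε)`,
because `Z` lies in the row space of `A` and `Uᵀ A Z ≈ 1`. Therefore
`Uperpᵀ Ut = ε Uperpᵀ W Z = ε W₀ Σ⁻¹ + O(ε ^ 2)` (`IsCompactSVD.isBigOPow_sub`).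
-/

/-! ### Orthogonal transformations of Gaussian matrices -/

/-- An orthonormal change of coordinates on both sides turns a matrix of independent `N(0, v)`
entries into a smaller one: the new entries are jointly Gaussian, being linear in the old ones,
and the orthonormality of the columns of `A` and `B` makes them uncorrelated with variance `v`. -/
theorem IsGaussianMatrix.transpose_mul_mul {Ω : Type*} [MeasurableSpace Ω] {μ : Measure Ω}
    [IsProbabilityMeasure μ] {p q p' q' : ℕ} {v : ℝ≥0} {W : Ω → Matrix (Fin p) (Fin q) ℝ}
    (hW : IsGaussianMatrix W v μ) {A : Matrix (Fin p) (Fin p') ℝ} {B : Matrix (Fin q) (Fin q') ℝ}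
    (hA : Aᵀ * A = 1) (hB : Bᵀ * B = 1) :
    IsGaussianMatrix (fun ω => Aᵀ * W ω * B) v μ := by
  have hg : ∀ k : Fin p × Fin q, HasGaussianLaw (fun ω => W ω k.1 k.2) μ :=
    fun k => (hW.law k.1 k.2).hasGaussianLaw
  have hL2 : ∀ k : Fin p × Fin q, MemLp (fun ω => W ω k.1 k.2) 2 μ := fun k => (hg k).memLp_two
  have hjoint := hW.indep.hasGaussianLaw hg
  have hentry : ∀ (k : Fin p' × Fin q') ω, (Aᵀ * W ω * B) k.1 k.2 =
      ∑ x : Fin p × Fin q, (A x.1 k.1 * B x.2 k.2) * W ω x.1 x.2 := by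
    intro k ω
    simp only [Matrix.mul_apply, Matrix.transpose_apply, Finset.sum_mul]
    rw [Fintype.sum_prod_type, Finset.sum_comm]
    exact Finset.sum_congr rfl fun _ _ => Finset.sum_congr rfl fun _ _ => by ring
  let L : ((Fin p × Fin q) → ℝ) →L[ℝ] ((Fin p' × Fin q') → ℝ) :=
    ContinuousLinearMap.pi fun k => ∑ x : Fin p × Fin q,
      (A x.1 k.1 * B x.2 k.2) • ContinuousLinearMap.proj x
  have hjoint' : HasGaussianLaw (fun ω => ((fun k : Fin p' × Fin q' =>
      (Aᵀ * W ω * B) k.1 k.2) : (Fin p' × Fin q') → ℝ)) μ := by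
    have hL : (fun ω => ((fun k : Fin p' × Fin q' => (Aᵀ * W ω * B) k.1 k.2) :
        (Fin p' × Fin q') → ℝ)) = fun ω => L fun x => W ω x.1 x.2 := by
      funext ω k
      simp [L, hentry]
    rw [hL]
    exact hjoint.map_fun L
  have hcovW : ∀ x y : Fin p × Fin q,
      cov[fun ω => W ω x.1 x.2, fun ω => W ω y.1 y.2; μ] = if x = y then (v : ℝ) else 0 := by
    intro x y
    split_ifs with h
    · subst h
      rw [covariance_self (hg x).aemeasurable, (hW.law x.1 x.2).variance_eq, variance_id_gaussianReal]
    · exact (hW.indep.indepFun h).covariance_eq_zero (hL2 x) (hL2 y)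
  have hcov : ∀ k l : Fin p' × Fin q', cov[fun ω => (Aᵀ * W ω * B) k.1 k.2,
      fun ω => (Aᵀ * W ω * B) l.1 l.2; μ] = if k = l then (v : ℝ) else 0 := by
    intro k l
    simp_rw [hentry]
    rw [covariance_fun_sum_fun_sum (fun x => (hL2 x).const_mul _) (fun x => (hL2 x).const_mul _)]
    simp_rw [covariance_const_mul_left, covariance_const_mul_right, hcovW]
    have hsum : ∑ x : Fin p × Fin q, ∑ y : Fin p × Fin q, A x.1 k.1 * B x.2 k.2 *
        (A y.1 l.1 * B y.2 l.2 * if x = y then (v : ℝ) else 0) =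
        (Aᵀ * A) k.1 l.1 * (Bᵀ * B) k.2 l.2 * v := by
      simp only [mul_ite, mul_zero, Finset.sum_ite_eq, Finset.mem_univ, if_true]
      rw [Fintype.sum_prod_type]
      simp only [Matrix.mul_apply, Matrix.transpose_apply]
      rw [Finset.sum_mul_sum, Finset.sum_mul]
      refine Finset.sum_congr rfl fun _ _ => ?_
      rw [Finset.sum_mul]
      exact Finset.sum_congr rfl fun _ _ => by ring
    rw [hsum, hA, hB, Matrix.one_apply, Matrix.one_apply]
    by_cases h1 : k.1 = l.1 <;> by_cases h2 : k.2 = l.2 <;> simp [h1, h2, Prod.ext_iff]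
  refine ⟨fun i j => ?_, hjoint'.iIndepFun_of_covariance_eq_zero fun k l hkl => ?_⟩
  · have hij := hjoint'.eval (i, j)
    refine ⟨hij.aemeasurable, ?_⟩
    have hmean : ∫ ω, (Aᵀ * W ω * B) i j ∂μ = 0 := by
      simp_rw [hentry (i, j)]
      rw [integral_finsetSum _ fun x _ => (hg x).integrable.const_mul _]
      refine Finset.sum_eq_zero fun x _ => ?_
      rw [integral_const_mul, (hW.law x.1 x.2).integral_eq, integral_id_gaussianReal, mul_zero]
    have hvar : Var[fun ω => (Aᵀ * W ω * B) i j; μ] = v := by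
      rw [← covariance_self hij.aemeasurable]
      simpa using hcov (i, j) (i, j)
    rw [hij.map_eq_gaussianReal, hmean, hvar, Real.toNNReal_coe]
  · simpa [hkl] using hcov k l

/-! ### Existence of singular-value decompositions -/

theorem transpose_mul_self_of_orthonormal {p q : ℕ} {b : Fin q → EuclideanSpace ℝ (Fin p)}
    (hb : Orthonormal ℝ b) :
    (Matrix.of fun i k => b k i)ᵀ * (Matrix.of fun i k => b k i) = (1 : Matrix (Fin q) (Fin q) ℝ) := by
  ext i j
  have h := orthonormal_iff_ite.mp hb i j
  simp only [PiLp.inner_apply, RCLike.inner_apply, conj_trivial] at h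
  simp only [Matrix.mul_apply, Matrix.transpose_apply, Matrix.of_apply, Matrix.one_apply, ← h]
  exact Finset.sum_congr rfl fun _ _ => mul_comm _ _

theorem mul_rectDiag_apply {p D N : ℕ} (P : Matrix (Fin p) (Fin D) ℝ) (s : ℕ → ℝ) (i : Fin p)
    (j : Fin N) :
    (P * rectDiag D N s) i j = if h : (j : ℕ) < D then P i ⟨j, h⟩ * s j else 0 := by
  simp only [Matrix.mul_apply, rectDiag, Matrix.of_apply, mul_ite, mul_zero]
  split_ifs with h
  · rw [Finset.sum_eq_single ⟨j, h⟩]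
    · simp
    · exact fun b _ hb => if_neg fun hbj => hb (Fin.ext hbj)
    · simp
  · exact Finset.sum_eq_zero fun b _ => if_neg (by omega)

theorem rectDiag_transpose (D N : ℕ) (s : ℕ → ℝ) : (rectDiag D N s)ᵀ = rectDiag N D s := by
  ext i j
  simp only [rectDiag, Matrix.transpose_apply, Matrix.of_apply]
  split_ifs with h1 h2 h2
  · rw [h1]
  · exact absurd h1.symm h2
  · exact absurd h2.symm h1
  · rfl

/-- Right singular vectors are eigenvectors of `Aᵀ A`; the normalized images of those with
nonzero singular value are orthonormal and extend to an orthonormal basis of left singular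
vectors. -/
theorem exists_isSVD {D N : ℕ} (A : Matrix (Fin D) (Fin N) ℝ) : ∃ P s R, IsSVD A P s R := by
  let T : EuclideanSpace ℝ (Fin N) →ₗ[ℝ] EuclideanSpace ℝ (Fin D) := Matrix.toEuclideanLin A
  let e := T.isSymmetric_adjoint_comp_self.eigenvectorBasis (finrank_euclideanSpace_fin (n := N))
  let s : ℕ → ℝ := T.singularValues
  have hinner : ∀ i j, inner ℝ (T (e i)) (T (e j)) = if i = j then s i ^ 2 else 0 := by
    intro i j
    rw [← LinearMap.adjoint_inner_left, ← LinearMap.comp_apply,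
      LinearMap.IsSymmetric.apply_eigenvectorBasis, inner_smul_left,
      orthonormal_iff_ite.mp e.orthonormal i j, T.sq_singularValues_fin finrank_euclideanSpace_fin]
    simp
  have hzero : ∀ j : Fin N, s j = 0 → T (e j) = 0 := by
    intro j hj
    rw [← inner_self_eq_zero (𝕜 := ℝ), hinner, if_pos rfl, hj]
    simp
  have hlt : ∀ k, 0 < s k → k < N ∧ k < D := by
    intro k hk
    have hr := T.singularValues_pos_iff_lt_finrank_range.mp hk
    refine ⟨hr.trans_le ?_, hr.trans_le ?_⟩
    · simpa using T.finrank_range_le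
    · simpa using T.range.finrank_le
  let u : Fin D → EuclideanSpace ℝ (Fin D) := fun k =>
    if h : (k : ℕ) < N then (s k)⁻¹ • T (e ⟨k, h⟩) else 0
  have hu : Orthonormal ℝ (({k : Fin D | 0 < s k} : Set (Fin D)).domRestrict u) := by
    rw [orthonormal_iff_ite]
    rintro ⟨i, hi⟩ ⟨j, hj⟩
    simp only [Set.domRestrict_apply, u, dif_pos (hlt _ hi).1, dif_pos (hlt _ hj).1,
      inner_smul_left, inner_smul_right, hinner, Subtype.mk.injEq, Fin.ext_iff]
    have hi' : s i ≠ 0 := ne_of_gt hi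
    split_ifs with h
    · rw [← h]
      simp only [conj_trivial]
      field_simp
    · simp
  obtain ⟨b, hb⟩ := hu.exists_orthonormalBasis_extension_of_card_eq (by simp)
  have hTe : ∀ j : Fin N, T (e j) = if h : (j : ℕ) < D then s j • b ⟨j, h⟩ else 0 := by
    intro j
    rcases (T.singularValues_nonneg j).eq_or_lt with h0 | hpos
    · rw [hzero j h0.symm]
      split_ifs
      · rw [show s j = 0 from h0.symm, zero_smul]
      · rfl
    · rw [dif_pos (hlt _ hpos).2, hb _ hpos]
      simp only [u, dif_pos j.2]
      rw [smul_smul, mul_inv_cancel₀ (ne_of_gt hpos), one_smul]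
  have hR := transpose_mul_self_of_orthonormal e.orthonormal
  refine ⟨Matrix.of fun i k => b k i, s, Matrix.of fun i k => e k i, ?_, ?_,
    T.singularValues_nonneg, T.singularValues_antitone, ?_⟩
  · rw [Matrix.mem_orthogonalGroup_iff']
    exact transpose_mul_self_of_orthonormal b.orthonormal
  · rw [Matrix.mem_orthogonalGroup_iff']
    exact hR
  · have hAR : A * (Matrix.of fun i k => e k i) = (Matrix.of fun i k => b k i) * rectDiag D N s := by
      ext i j
      have h := congrArg (fun x : EuclideanSpace ℝ (Fin D) => x i) (hTe j)
      rw [mul_rectDiag_apply]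
      have hL : (A * (Matrix.of fun i k => e k i : Matrix (Fin N) (Fin N) ℝ)) i j = T (e j) i := rfl
      rw [hL, h]
      split_ifs <;> simp [mul_comm]
    rw [← hAR, Matrix.mul_assoc, mul_eq_one_comm.mp hR, Matrix.mul_one]

/-! ### Leading singular vectors and bounds on singular values -/

section LeadingVectors

variable {D N : ℕ} {A : Matrix (Fin D) (Fin N) ℝ} {P : Matrix (Fin D) (Fin D) ℝ} {s : ℕ → ℝ}
  {R : Matrix (Fin N) (Fin N) ℝ}

/-- The matrix formed by the first `m` columns of `P`. -/
def leadingCols {p q m : ℕ} (hm : m ≤ q) (P : Matrix (Fin p) (Fin q) ℝ) :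
    Matrix (Fin p) (Fin m) ℝ :=
  P.submatrix id (Fin.castLE hm)

theorem transpose_leadingCols_mul_self {p m : ℕ} (hm : m ≤ p) {P : Matrix (Fin p) (Fin p) ℝ}
    (hP : Pᵀ * P = 1) : (leadingCols hm P)ᵀ * leadingCols hm P = 1 := by
  have h : (leadingCols hm P)ᵀ * leadingCols hm P =
      (Pᵀ * P).submatrix (Fin.castLE hm) (Fin.castLE hm) := rfl
  rw [h, hP, Matrix.submatrix_one _ (Fin.castLE_injective hm)]

theorem IsSVD.transpose_mul_left (h : IsSVD A P s R) : Pᵀ * P = 1 :=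
  (Matrix.mem_orthogonalGroup_iff' _ _).mp h.left_orthogonal

theorem IsSVD.transpose_mul_right (h : IsSVD A P s R) : Rᵀ * R = 1 :=
  (Matrix.mem_orthogonalGroup_iff' _ _).mp h.right_orthogonal

theorem IsSVD.transpose (h : IsSVD A P s R) : IsSVD Aᵀ R s P where
  left_orthogonal := h.right_orthogonal
  right_orthogonal := h.left_orthogonal
  nonneg := h.nonneg
  antitone := h.antitone
  eq_mul := by
    rw [h.eq_mul, Matrix.transpose_mul, Matrix.transpose_mul, Matrix.transpose_transpose,
      rectDiag_transpose, Matrix.mul_assoc]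

theorem IsSVD.mul_right (h : IsSVD A P s R) : A * R = P * rectDiag D N s := by
  rw [h.eq_mul, Matrix.mul_assoc, h.transpose_mul_right, Matrix.mul_one]

theorem IsSVD.mul_leadingCols (h : IsSVD A P s R) {m : ℕ} (hD : m ≤ D) (hN : m ≤ N) :
    A * leadingCols hN R = leadingCols hD P * Matrix.diagonal fun k : Fin m => s k := by
  have h1 : A * leadingCols hN R = leadingCols hN (A * R) := rfl
  ext i j
  rw [h1, h.mul_right, Matrix.mul_diagonal]
  simp only [leadingCols, Matrix.submatrix_apply, id, mul_rectDiag_apply, Fin.val_castLE]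
  rw [dif_pos (j.2.trans_le hD)]
  rfl

theorem dotProduct_mulVec_self {p q : ℕ} {Q : Matrix (Fin p) (Fin q) ℝ} (hQ : Qᵀ * Q = 1)
    (v : Fin q → ℝ) : Q *ᵥ v ⬝ᵥ Q *ᵥ v = v ⬝ᵥ v := by
  rw [Matrix.dotProduct_mulVec, ← Matrix.mulVec_transpose, Matrix.mulVec_mulVec, hQ,
    Matrix.one_mulVec]

theorem dotProduct_diagonal_mulVec_self {q : ℕ} (d v : Fin q → ℝ) :
    Matrix.diagonal d *ᵥ v ⬝ᵥ Matrix.diagonal d *ᵥ v = ∑ k, d k ^ 2 * v k ^ 2 := by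
  simp only [dotProduct, Matrix.mulVec_diagonal]
  exact Finset.sum_congr rfl fun _ _ => by ring

theorem dotProduct_mulVec_self_le {p q : ℕ} (B : Matrix (Fin p) (Fin q) ℝ) (v : Fin q → ℝ) :
    B *ᵥ v ⬝ᵥ B *ᵥ v ≤ (∑ i, ∑ j, B i j ^ 2) * (v ⬝ᵥ v) := by
  simp only [dotProduct, Matrix.mulVec, Finset.sum_mul]
  refine Finset.sum_le_sum fun i _ => ?_
  have h := Finset.sum_mul_sq_le_sq_mul_sq Finset.univ (B i) v
  simp only [← pow_two, ← Finset.sum_mul]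
  exact h

theorem exists_ne_zero_mulVec_eq_zero {p q : ℕ} (h : p < q) (B : Matrix (Fin p) (Fin q) ℝ) :
    ∃ v, v ≠ 0 ∧ B *ᵥ v = 0 := by
  have hker : LinearMap.ker B.mulVecLin ≠ ⊥ := LinearMap.ker_ne_bot_of_finrank_lt (by simpa using h)
  obtain ⟨v, hv, hv0⟩ := (Submodule.ne_bot_iff _).mp hker
  exact ⟨v, hv0, by simpa using hv⟩

theorem le_of_transpose_mul_self_eq_one {p q : ℕ} {Q : Matrix (Fin p) (Fin q) ℝ}
    (hQ : Qᵀ * Q = 1) : q ≤ p := by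
  by_contra! h
  obtain ⟨v, hv0, hv⟩ := exists_ne_zero_mulVec_eq_zero h Q
  apply hv0
  rw [← Matrix.one_mulVec v, ← hQ, ← Matrix.mulVec_mulVec, hv, Matrix.mulVec_zero]

theorem dotProduct_self_pos_of_ne_zero {q : ℕ} {v : Fin q → ℝ} (hv : v ≠ 0) : 0 < v ⬝ᵥ v := by
  have h : 0 ≤ v ⬝ᵥ v := Finset.sum_nonneg fun _ _ => mul_self_nonneg _
  exact h.lt_of_ne fun h0 => hv (dotProduct_self_eq_zero.mp h0.symm)

/-- On vectors orthogonal to the first `k` right singular vectors, `A` is bounded by its singular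
value of index `k`. -/
theorem IsSVD.dotProduct_mulVec_le (h : IsSVD A P s R) {k : ℕ} {v : Fin N → ℝ}
    (hv : ∀ j : Fin N, (j : ℕ) < k → (Rᵀ *ᵥ v) j = 0) :
    A *ᵥ v ⬝ᵥ A *ᵥ v ≤ s k ^ 2 * (v ⬝ᵥ v) := by
  set w := Rᵀ *ᵥ v with hw
  have hwv : w ⬝ᵥ w = v ⬝ᵥ v :=
    dotProduct_mulVec_self (by
      rw [Matrix.transpose_transpose]; exact mul_eq_one_comm.mp h.transpose_mul_right) v
  have hAv : A *ᵥ v = P *ᵥ (rectDiag D N s *ᵥ w) := by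
    rw [h.eq_mul, hw, Matrix.mulVec_mulVec, Matrix.mulVec_mulVec, Matrix.mul_assoc]
  have hSw : rectDiag D N s *ᵥ w ⬝ᵥ rectDiag D N s *ᵥ w ≤ s k ^ 2 * (w ⬝ᵥ w) := by
    have hdiag : (rectDiag D N s)ᵀ * rectDiag D N s =
        Matrix.diagonal fun j : Fin N => if (j : ℕ) < D then s j ^ 2 else 0 := by
      ext i j
      rw [mul_rectDiag_apply, Matrix.diagonal_apply]
      simp only [rectDiag, Matrix.transpose_apply, Matrix.of_apply, Fin.ext_iff]
      grind
    rw [Matrix.dotProduct_mulVec, ← Matrix.mulVec_transpose, Matrix.mulVec_mulVec, hdiag]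
    simp only [dotProduct, Matrix.mulVec_diagonal, Finset.mul_sum]
    refine Finset.sum_le_sum fun j _ => ?_
    rcases lt_or_ge (j : ℕ) k with hj | hj
    · rw [hv j hj]; simp
    · have hs : s j ^ 2 ≤ s k ^ 2 := pow_le_pow_left₀ (h.nonneg _) (h.antitone hj) 2
      split_ifs
      · nlinarith [mul_self_nonneg (w j)]
      · nlinarith [mul_self_nonneg (w j), sq_nonneg (s k)]
  rw [hAv, dotProduct_mulVec_self h.transpose_mul_left, ← hwv]
  exact hSw

section Perturbation

variable {m : ℕ} {X E : Matrix (Fin D) (Fin N) ℝ} {U : Matrix (Fin D) (Fin m) ℝ} {lam : Fin m → ℝ}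
  {V : Matrix (Fin N) (Fin m) ℝ} {l c : ℝ}

/-- Lower bound for the first `m` singular values of a perturbed rank-`m` matrix. By a dimension
count some nonzero vector in the row space of `X` is orthogonal to the first `k` right singular
vectors of `X + E`. -/
theorem IsCompactSVD.sq_le_of_isSVD_add (hX : IsCompactSVD X U lam V) (hl : 0 ≤ l)
    (hlam : ∀ k, l ≤ lam k) (hE : ∀ v, E *ᵥ v ⬝ᵥ E *ᵥ v ≤ c * (v ⬝ᵥ v))
    (h : IsSVD (X + E) P s R) (k : Fin m) : l ^ 2 ≤ 2 * s k ^ 2 + 2 * c := by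
  have hmN : m ≤ N := le_of_transpose_mul_self_eq_one hX.right_orthonormal
  have hkN : (k : ℕ) ≤ N := k.2.le.trans hmN
  obtain ⟨d, hd0, hd⟩ := exists_ne_zero_mulVec_eq_zero k.2 ((leadingCols hkN R)ᵀ * V)
  have hAv := h.dotProduct_mulVec_le (k := k) (v := V *ᵥ d) fun j hj => by
    have := congrFun hd ⟨j, hj⟩
    rw [← Matrix.mulVec_mulVec] at this
    exact this
  have hEv := hE (V *ᵥ d)
  rw [dotProduct_mulVec_self hX.right_orthonormal] at hAv hEv
  have hXv : l ^ 2 * (d ⬝ᵥ d) ≤ X *ᵥ (V *ᵥ d) ⬝ᵥ X *ᵥ (V *ᵥ d) := by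
    have : X *ᵥ (V *ᵥ d) = U *ᵥ (Matrix.diagonal lam *ᵥ d) := by
      rw [hX.eq_mul, Matrix.mulVec_mulVec, Matrix.mul_assoc, hX.right_orthonormal, Matrix.mul_one,
        Matrix.mulVec_mulVec]
    rw [this, dotProduct_mulVec_self hX.left_orthonormal, dotProduct_diagonal_mulVec_self]
    simp only [dotProduct, Finset.mul_sum, ← pow_two]
    exact Finset.sum_le_sum fun j _ => by gcongr; exact hlam j
  have hsum : X *ᵥ (V *ᵥ d) ⬝ᵥ X *ᵥ (V *ᵥ d) ≤
      2 * ((X + E) *ᵥ (V *ᵥ d) ⬝ᵥ (X + E) *ᵥ (V *ᵥ d)) +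
        2 * (E *ᵥ (V *ᵥ d) ⬝ᵥ E *ᵥ (V *ᵥ d)) := by
    rw [Matrix.add_mulVec]
    simp only [dotProduct, Finset.mul_sum, ← Finset.sum_add_distrib, Pi.add_apply]
    exact Finset.sum_le_sum fun j _ => by
      nlinarith [sq_nonneg ((X *ᵥ V *ᵥ d) j + 2 * (E *ᵥ V *ᵥ d) j)]
  have hpos := dotProduct_self_pos_of_ne_zero hd0
  nlinarith

/-- Upper bound for the remaining singular values of a perturbed rank-`m` matrix. By a dimension
count the span of the first `m + 1` right singular vectors of `X + E` meets the kernel of `X`. -/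
theorem IsCompactSVD.isSVD_add_sq_le (hX : IsCompactSVD X U lam V)
    (hE : ∀ v, E *ᵥ v ⬝ᵥ E *ᵥ v ≤ c * (v ⬝ᵥ v)) (h : IsSVD (X + E) P s R) (hD : m < D)
    (hN : m < N) : s m ^ 2 ≤ c := by
  obtain ⟨d, hd0, hd⟩ := exists_ne_zero_mulVec_eq_zero (Nat.lt_succ_self m)
    (Vᵀ * leadingCols (Nat.succ_le_of_lt hN) R)
  have hR := transpose_leadingCols_mul_self (Nat.succ_le_of_lt hN) h.transpose_mul_right
  have hP := transpose_leadingCols_mul_self (Nat.succ_le_of_lt hD) h.transpose_mul_left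
  set v := leadingCols (Nat.succ_le_of_lt hN) R *ᵥ d with hv
  have hXv : X *ᵥ v = 0 := by
    have hVv : Vᵀ *ᵥ v = 0 := by rw [hv, Matrix.mulVec_mulVec, hd]
    rw [hX.eq_mul, ← Matrix.mulVec_mulVec, hVv, Matrix.mulVec_zero]
  have hEv := hE v
  have hEA : E *ᵥ v = leadingCols (Nat.succ_le_of_lt hD) P *ᵥ
      (Matrix.diagonal (fun k : Fin (m + 1) => s k) *ᵥ d) := by
    have hadd : E *ᵥ v = (X + E) *ᵥ v := by rw [Matrix.add_mulVec, hXv, zero_add]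
    rw [hadd, hv, Matrix.mulVec_mulVec, h.mul_leadingCols (Nat.succ_le_of_lt hD),
      Matrix.mulVec_mulVec]
  rw [hEA, dotProduct_mulVec_self hP, dotProduct_diagonal_mulVec_self, hv,
    dotProduct_mulVec_self hR] at hEv
  have hlow : s m ^ 2 * (d ⬝ᵥ d) ≤ ∑ k : Fin (m + 1), s k ^ 2 * d k ^ 2 := by
    simp only [dotProduct, Finset.mul_sum, ← pow_two]
    refine Finset.sum_le_sum fun j _ => ?_
    have hs := pow_le_pow_left₀ (h.nonneg m) (h.antitone (Nat.le_of_lt_succ j.2)) 2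
    gcongr
  have hpos := dotProduct_self_pos_of_ne_zero hd0
  exact le_of_mul_le_mul_right (hlow.trans hEv) hpos

end Perturbation

/-! ### Uniqueness of the top singular subspace -/

theorem IsSVD.mul_transpose_mul_left (h : IsSVD A P s R) :
    A * Aᵀ * P = P * Matrix.diagonal fun k : Fin D => if (k : ℕ) < N then s k ^ 2 else 0 := by
  have hdiag : rectDiag D N s * rectDiag N D s =
      Matrix.diagonal fun k : Fin D => if (k : ℕ) < N then s k ^ 2 else 0 := by
    ext i j
    rw [mul_rectDiag_apply, Matrix.diagonal_apply]
    simp only [rectDiag, Matrix.of_apply, Fin.ext_iff]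
    grind
  rw [Matrix.mul_assoc, h.transpose.mul_right, ← Matrix.mul_assoc, h.mul_right, Matrix.mul_assoc,
    hdiag]

/-- If a threshold `τ` separates the first `m` squared singular values from the others in two
singular-value decompositions of `A`, then the leading left singular vectors of the second lie in
the span of those of the first: eigenvectors of `A Aᵀ` for distinct eigenvalues are orthogonal. -/
theorem IsSVD.span_le_span {P' : Matrix (Fin D) (Fin D) ℝ} {s' : ℕ → ℝ}
    {R' : Matrix (Fin N) (Fin N) ℝ} (h : IsSVD A P s R) (h' : IsSVD A P' s' R') {m : ℕ}
    (hmN : m ≤ N) {τ : ℝ} (hτ : 0 ≤ τ) (hlow : m < N → s m ^ 2 ≤ τ)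
    (hhigh : ∀ k < m, τ < s' k ^ 2) :
    Submodule.span ℝ (P'.col '' {k : Fin D | (k : ℕ) < m}) ≤
      Submodule.span ℝ (P.col '' {k : Fin D | (k : ℕ) < m}) := by
  set t : Fin D → ℝ := fun k => if (k : ℕ) < N then s k ^ 2 else 0 with ht
  set t' : Fin D → ℝ := fun k => if (k : ℕ) < N then s' k ^ 2 else 0 with ht'
  have hPP : P * Pᵀ = 1 := mul_eq_one_comm.mp h.transpose_mul_left
  have hK : Matrix.diagonal t * (Pᵀ * P') = Pᵀ * P' * Matrix.diagonal t' := by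
    have h1 : Pᵀ * (A * Aᵀ) = Matrix.diagonal t * Pᵀ := by
      have := congrArg Matrix.transpose h.mul_transpose_mul_left
      simpa [Matrix.transpose_mul, Matrix.diagonal_transpose] using this
    rw [← Matrix.mul_assoc, ← h1, Matrix.mul_assoc, h'.mul_transpose_mul_left, ← Matrix.mul_assoc]
  have hzero : ∀ i j : Fin D, m ≤ (i : ℕ) → (j : ℕ) < m → (Pᵀ * P') i j = 0 := by
    intro i j hi hj
    have hij := congrFun (congrFun hK i) j
    rw [Matrix.diagonal_mul, Matrix.mul_diagonal] at hij
    have htj : τ < t' j := by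
      simp only [ht', if_pos (hj.trans_le hmN)]
      exact hhigh j hj
    have hti : t i ≤ τ := by
      simp only [ht]
      split_ifs with hiN
      · exact (pow_le_pow_left₀ (h.nonneg _) (h.antitone hi) 2).trans (hlow (hi.trans_lt hiN))
      · exact hτ
    have hne : t' j - t i ≠ 0 := by linarith [htj, hti] |> ne_of_gt
    exact (mul_eq_zero.mp (by linarith : (t' j - t i) * (Pᵀ * P') i j = 0)).resolve_left hne
  rw [Submodule.span_le]
  rintro _ ⟨j, hj, rfl⟩
  have hcol : P'.col j = ∑ i, (Pᵀ * P') i j • P.col i := by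
    have hP' : P' = P * (Pᵀ * P') := by rw [← Matrix.mul_assoc, hPP, Matrix.one_mul]
    ext a
    conv_lhs => rw [hP']
    simp only [Matrix.col_apply, Finset.sum_apply, Pi.smul_apply, smul_eq_mul]
    rw [Matrix.mul_apply]
    exact Finset.sum_congr rfl fun _ _ => mul_comm _ _
  rw [hcol]
  refine Submodule.sum_mem _ fun i _ => ?_
  rcases lt_or_ge (i : ℕ) m with hi | hi
  · exact Submodule.smul_mem _ _ (Submodule.subset_span ⟨i, hi, rfl⟩)
  · rw [hzero i j hi hj, zero_smul]
    exact Submodule.zero_mem _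

theorem span_col_image_eq_colSpan {m : ℕ} (hm : m ≤ D) (P : Matrix (Fin D) (Fin D) ℝ) :
    Submodule.span ℝ (P.col '' {k : Fin D | (k : ℕ) < m}) = colSpan (leadingCols hm P) := by
  rw [colSpan, Matrix.range_mulVecLin]
  congr 1
  ext x
  constructor
  · rintro ⟨k, hk, rfl⟩
    exact ⟨⟨k, hk⟩, rfl⟩
  · rintro ⟨k, rfl⟩
    exact ⟨Fin.castLE hm k, k.2, rfl⟩

theorem colSpan_mul_of_mul_eq_one {m : ℕ} (B : Matrix (Fin D) (Fin m) ℝ)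
    {Q Q' : Matrix (Fin m) (Fin m) ℝ} (hQ : Q * Q' = 1) : colSpan (B * Q) = colSpan B := by
  have hle : ∀ (B : Matrix (Fin D) (Fin m) ℝ) (Q : Matrix (Fin m) (Fin m) ℝ),
      colSpan (B * Q) ≤ colSpan B := by
    intro B Q
    rw [colSpan, colSpan, Matrix.mulVecLin_mul]
    exact LinearMap.range_comp_le_range _ _
  refine (hle B Q).antisymm ?_
  simpa [Matrix.mul_assoc, hQ] using hle (B * Q) Q'

end LeadingVectors

/-! ### Entrywise asymptotics of matrix families -/

/-- `F ε = O(ε ^ n)` as `ε → 0`, entry by entry. -/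
def IsBigOPow {p q : ℕ} (F : ℝ → Matrix (Fin p) (Fin q) ℝ) (n : ℕ) : Prop :=
  ∀ i j, (fun ε : ℝ => F ε i j) =O[𝓝 0] fun ε : ℝ => ε ^ n

namespace IsBigOPow

variable {p q r n k : ℕ} {F G : ℝ → Matrix (Fin p) (Fin q) ℝ} {H : ℝ → Matrix (Fin q) (Fin r) ℝ}

theorem congr' (hF : IsBigOPow F n) (h : ∀ᶠ ε in 𝓝 0, F ε = G ε) : IsBigOPow G n :=
  fun i j =>
  (hF i j).congr' (h.mono fun _ hε => congrFun (congrFun hε i) j) EventuallyEq.rfl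

theorem add (hF : IsBigOPow F n) (hG : IsBigOPow G n) : IsBigOPow (fun ε => F ε + G ε) n :=
  fun i j => (hF i j).add (hG i j)

theorem sub (hF : IsBigOPow F n) (hG : IsBigOPow G n) : IsBigOPow (fun ε => F ε - G ε) n :=
  fun i j => (hF i j).sub (hG i j)

theorem transpose (hF : IsBigOPow F n) : IsBigOPow (fun ε => (F ε)ᵀ) n := fun i j => hF j i

theorem mul (hF : IsBigOPow F n) (hH : IsBigOPow H k) :
    IsBigOPow (fun ε => F ε * H ε) (n + k) := fun i j => by
  simp only [Matrix.mul_apply, pow_add]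
  exact IsBigO.fun_sum fun l _ => (hF i l).mul (hH l j)

theorem smul (hF : IsBigOPow F n) : IsBigOPow (fun ε => ε • F ε) (n + 1) := fun i j => by
  simp only [Matrix.smul_apply, smul_eq_mul, pow_succ']
  exact (isBigO_refl _ _).mul (hF i j)

theorem const (B : Matrix (Fin p) (Fin q) ℝ) : IsBigOPow (fun _ => B) 0 := fun i j => by
  simpa using isBigO_const_const (B i j) (one_ne_zero (α := ℝ)) (𝓝 (0 : ℝ))

theorem const_mul (B : Matrix (Fin r) (Fin p) ℝ) (hF : IsBigOPow F n) :
    IsBigOPow (fun ε => B * F ε) n := by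
  simpa using (const B).mul hF

theorem of_le (hF : IsBigOPow F n) (h : k ≤ n) : IsBigOPow F k := fun i j =>
  (hF i j).trans <| IsBigO.of_bound 1 <| by
    filter_upwards [Metric.ball_mem_nhds (0 : ℝ) one_pos] with ε hε
    rw [one_mul, norm_pow, norm_pow]
    exact pow_le_pow_of_le_one (norm_nonneg _) (mem_ball_zero_iff.mp hε).le h

theorem of_orthonormal (h : ∀ ε, (F ε)ᵀ * F ε = 1) : IsBigOPow F 0 := fun i j => by
  refine IsBigO.of_bound 1 (Eventually.of_forall fun ε => ?_)
  have hsum := congrFun (congrFun (h ε) j) j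
  simp only [Matrix.mul_apply, Matrix.transpose_apply, Matrix.one_apply_eq, ← pow_two] at hsum
  have hle := Finset.single_le_sum (f := fun l => F ε l j ^ 2) (fun l _ => sq_nonneg _)
    (Finset.mem_univ i)
  simp only [pow_zero, norm_one, mul_one, Real.norm_eq_abs]
  exact (sq_le_one_iff_abs_le_one _).mp (hle.trans hsum.le)

/-- If `Mᵀ M = 1 + O(ε ^ n)`, then `M` agrees with its orthogonal polar factor to the same order.
Here `M = A S Bᵀ` is a singular-value decomposition, the polar factor is `A Bᵀ`, and the reason is
that `|1 - s| ≤ |1 - s ^ 2|` for every singular value `s ≥ 0`. -/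
theorem one_sub_mul_polar {M A B : ℝ → Matrix (Fin p) (Fin p) ℝ} {s : ℝ → ℕ → ℝ}
    (hM : IsBigOPow (fun ε => 1 - (M ε)ᵀ * M ε) n) (h : ∀ ε, IsSVD (M ε) (A ε) (s ε) (B ε)) :
    IsBigOPow (fun ε => 1 - M ε * (B ε * (A ε)ᵀ)) n := by
  have hS : ∀ ε, M ε = A ε * Matrix.diagonal (fun k : Fin p => s ε k) * (B ε)ᵀ := fun ε => by
    have hd : rectDiag p p (s ε) = Matrix.diagonal fun k : Fin p => s ε k := by
      ext i j
      simp [rectDiag, Matrix.diagonal_apply, Fin.ext_iff]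
    rw [← hd]
    exact (h ε).eq_mul
  have hA := fun ε => (h ε).transpose_mul_left
  have hB := fun ε => (h ε).transpose_mul_right
  have hA0 := of_orthonormal hA
  have hB0 := of_orthonormal hB
  have hsq : IsBigOPow (fun ε => Matrix.diagonal fun k : Fin p => 1 - s ε k ^ 2) n := by
    refine (((hB0.transpose.mul hM).mul hB0).of_le (by omega)).congr' (Eventually.of_forall fun ε => ?_)
    have hMB : M ε * B ε = A ε * Matrix.diagonal (fun k : Fin p => s ε k) := by
      rw [hS, Matrix.mul_assoc, hB, Matrix.mul_one]
    calc (B ε)ᵀ * (1 - (M ε)ᵀ * M ε) * B ε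
        = (B ε)ᵀ * B ε - (M ε * B ε)ᵀ * (M ε * B ε) := by
          simp only [Matrix.mul_sub, Matrix.sub_mul, Matrix.mul_one, Matrix.transpose_mul,
            Matrix.mul_assoc]
      _ = 1 - Matrix.diagonal (fun k : Fin p => s ε k) *
            Matrix.diagonal (fun k : Fin p => s ε k) := by
          rw [hB, hMB, Matrix.transpose_mul, Matrix.mul_assoc, ← Matrix.mul_assoc (A ε)ᵀ, hA,
            Matrix.one_mul, Matrix.diagonal_transpose]
      _ = Matrix.diagonal fun k : Fin p => 1 - s ε k ^ 2 := by
          rw [Matrix.diagonal_mul_diagonal, ← Matrix.diagonal_one, Matrix.diagonal_sub]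
          simp only [pow_two]
  have hdiag : IsBigOPow (fun ε => Matrix.diagonal fun k : Fin p => 1 - s ε k) n := by
    intro i j
    refine IsBigO.trans (IsBigO.of_bound 1 (Eventually.of_forall fun ε => ?_)) (hsq i j)
    have hs := (h ε).nonneg i
    simp only [Matrix.diagonal_apply, one_mul]
    split_ifs
    · rw [show 1 - s ε i ^ 2 = (1 - s ε i) * (1 + s ε i) by ring, norm_mul]
      refine le_mul_of_one_le_right (norm_nonneg _) ?_
      rw [Real.norm_of_nonneg (by linarith)]
      linarith
    · exact le_rfl
  refine (((hA0.mul hdiag).mul hA0.transpose).of_le (by omega)).congr'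
    (Eventually.of_forall fun ε => ?_)
  have hAA : A ε * (A ε)ᵀ = 1 := mul_eq_one_comm.mp (hA ε)
  have hMQ : M ε * (B ε * (A ε)ᵀ) = A ε * Matrix.diagonal (fun k : Fin p => s ε k) * (A ε)ᵀ := by
    rw [hS, Matrix.mul_assoc, ← Matrix.mul_assoc (B ε)ᵀ, hB, Matrix.one_mul]
  have hsub : (Matrix.diagonal fun k : Fin p => 1 - s ε k) =
      1 - Matrix.diagonal (fun k : Fin p => s ε k) := by
    rw [← Matrix.diagonal_one, Matrix.diagonal_sub]
  rw [hMQ, hsub, Matrix.mul_sub, Matrix.sub_mul, Matrix.mul_one, hAA]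

end IsBigOPow

/-! ### First-order expansion of the top singular subspace -/

theorem IsOrthonormalComplement.transpose_mul {D m : ℕ} {U : Matrix (Fin D) (Fin m) ℝ}
    {Uperp : Matrix (Fin D) (Fin (D - m)) ℝ} (h : IsOrthonormalComplement U Uperp) :
    Uperpᵀ * U = 0 := by
  simpa [Matrix.transpose_mul] using congrArg Matrix.transpose h.orthogonal

theorem IsOrthonormalComplement.mul_transpose_add {D m : ℕ} (hm : m ≤ D)
    {U : Matrix (Fin D) (Fin m) ℝ} {Uperp : Matrix (Fin D) (Fin (D - m)) ℝ} (hU : Uᵀ * U = 1)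
    (h : IsOrthonormalComplement U Uperp) : U * Uᵀ + Uperp * Uperpᵀ = 1 := by
  have e : Fin D ≃ Fin m ⊕ Fin (D - m) :=
    (finCongr (Nat.add_sub_cancel' hm).symm).trans finSumFinEquiv.symm
  rw [← Matrix.fromCols_mul_fromRows, Matrix.fromCols_mul_fromRows_eq_one_comm e,
    Matrix.fromRows_mul_fromCols, hU, h.orthonormal, h.orthogonal, h.transpose_mul,
    Matrix.fromBlocks_one]

section Expansion

variable {D N m : ℕ} {X : Matrix (Fin D) (Fin N) ℝ} {U : Matrix (Fin D) (Fin m) ℝ}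
  {lam : Fin m → ℝ} {V : Matrix (Fin N) (Fin m) ℝ} {Uperp : Matrix (Fin D) (Fin (D - m)) ℝ}

/-- The component of `X + ε W` orthogonal to the columns of `U` comes from the perturbation only. -/
theorem IsCompactSVD.perp_mul_add_smul_mul (hX : IsCompactSVD X U lam V)
    (hUperp : IsOrthonormalComplement U Uperp) (W : Matrix (Fin D) (Fin N) ℝ) (ε : ℝ)
    (Z : Matrix (Fin N) (Fin m) ℝ) :
    Uperpᵀ * ((X + ε • W) * Z) = ε • (Uperpᵀ * (W * Z)) := by
  have hperpX : Uperpᵀ * X = 0 := by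
    rw [hX.eq_mul, ← Matrix.mul_assoc, ← Matrix.mul_assoc, hUperp.transpose_mul, Matrix.zero_mul,
      Matrix.zero_mul]
  rw [Matrix.add_mul, Matrix.mul_add, ← Matrix.mul_assoc, hperpX, Matrix.zero_mul, zero_add,
    Matrix.smul_mul, Matrix.mul_smul]

/-- A frame `Ut = (X + ε W) Z` with `Uᵀ Ut = 1 + O(ε ^ 2)` has the expected expansion if `Z` is
bounded and lies in the range of `(X + ε W)ᵀ` boundedly. The latter forces `Z` to lie in the column
space of `V` up to `O(ε)`, and then `Uᵀ Ut ≈ 1` forces `Z = V Σ⁻¹ + O(ε)`. -/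
theorem IsCompactSVD.isBigOPow_sub (hX : IsCompactSVD X U lam V) (hm : m ≤ D)
    (hUperp : IsOrthonormalComplement U Uperp) (W : Matrix (Fin D) (Fin N) ℝ)
    {Ut G : ℝ → Matrix (Fin D) (Fin m) ℝ} {Z : ℝ → Matrix (Fin N) (Fin m) ℝ}
    (hZ : IsBigOPow Z 0) (hG : IsBigOPow G 0) (hUt : IsBigOPow (fun ε => 1 - Uᵀ * Ut ε) 2)
    (hAZ : ∀ᶠ ε in 𝓝 (0 : ℝ), (X + ε • W) * Z ε = Ut ε)
    (hAG : ∀ᶠ ε in 𝓝 (0 : ℝ), (X + ε • W)ᵀ * G ε = Z ε) :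
    IsBigOPow (fun ε => Ut ε -
      (U + ε • (Uperp * (Uperpᵀ * W * V) * (Matrix.diagonal lam)⁻¹))) 2 := by
  set S := Matrix.diagonal lam with hS
  have hSinv : S⁻¹ * S = 1 := by
    refine Matrix.nonsing_inv_mul _ ?_
    rw [hS, Matrix.det_diagonal, isUnit_iff_ne_zero]
    exact Finset.prod_ne_zero_iff.mpr fun k _ => (hX.pos k).ne'
  have hXt : Xᵀ = V * (S * Uᵀ) := by
    rw [hX.eq_mul, Matrix.transpose_mul, Matrix.transpose_mul, Matrix.transpose_transpose,
      Matrix.diagonal_transpose]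
  have hUX : Uᵀ * X = S * Vᵀ := by
    rw [hX.eq_mul, ← Matrix.mul_assoc, ← Matrix.mul_assoc, hX.left_orthonormal, Matrix.one_mul]
  have hZ1 : IsBigOPow (fun ε => Z ε - V * (Vᵀ * Z ε)) 1 := by
    refine (((hG.const_mul Wᵀ).const_mul (1 - V * Vᵀ)).smul).congr' (hAG.mono fun ε hε => ?_)
    have hkill : (1 - V * Vᵀ) * Xᵀ = 0 := by
      rw [hXt, Matrix.sub_mul, Matrix.one_mul, Matrix.mul_assoc V, ← Matrix.mul_assoc Vᵀ,
        hX.right_orthonormal, Matrix.one_mul, sub_self]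
    have hproj : Z ε - V * (Vᵀ * Z ε) = (1 - V * Vᵀ) * Z ε := by
      rw [Matrix.sub_mul, Matrix.one_mul, Matrix.mul_assoc]
    rw [hproj, ← hε, Matrix.transpose_add, Matrix.transpose_smul, Matrix.add_mul, Matrix.mul_add,
      ← Matrix.mul_assoc _ Xᵀ, hkill, Matrix.zero_mul, zero_add, Matrix.smul_mul, Matrix.mul_smul]
  have hZ2 : IsBigOPow (fun ε => S⁻¹ - Vᵀ * Z ε) 1 := by
    refine (((hUt.of_le (k := 1) (by norm_num)).add
      ((hZ.const_mul W).const_mul Uᵀ).smul).const_mul S⁻¹).congr' (hAZ.mono fun ε hε => ?_)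
    have hsplit : Uᵀ * Ut ε = S * (Vᵀ * Z ε) + ε • (Uᵀ * (W * Z ε)) := by
      rw [← hε, Matrix.add_mul, Matrix.mul_add, ← Matrix.mul_assoc, hUX, Matrix.mul_assoc,
        Matrix.smul_mul, Matrix.mul_smul]
    rw [hsplit, sub_add_eq_sub_sub, sub_add_cancel, Matrix.mul_sub, Matrix.mul_one,
      ← Matrix.mul_assoc, hSinv, Matrix.one_mul]
  have hZ3 : IsBigOPow (fun ε => Z ε - V * S⁻¹) 1 :=
    (hZ1.sub (hZ2.const_mul V)).congr' (Eventually.of_forall fun ε => by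
      rw [Matrix.mul_sub]
      abel)
  refine ((((hZ3.const_mul W).const_mul Uperpᵀ).const_mul Uperp).smul.sub (hUt.const_mul U)).congr'
    (hAZ.mono fun ε hε => ?_)
  have hdecomp : Ut ε = U * (Uᵀ * Ut ε) + ε • (Uperp * (Uperpᵀ * (W * Z ε))) := by
    have hperpUt := hX.perp_mul_add_smul_mul hUperp W ε (Z ε)
    rw [hε] at hperpUt
    rw [← Matrix.mul_smul, ← hperpUt, ← Matrix.mul_assoc, ← Matrix.mul_assoc, ← Matrix.add_mul,
      hUperp.mul_transpose_add hm hX.left_orthonormal, Matrix.one_mul]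
  conv_rhs => rw [hdecomp]
  simp only [Matrix.mul_sub, Matrix.mul_one, Matrix.mul_assoc, smul_sub]
  abel

/-- For a fixed perturbation `W`, the top singular subspace of `X + ε W` is eventually unique and
spanned by an orthonormal frame with the stated expansion. The frame is obtained from leading left
singular vectors `P₁` by rotating them with the transpose of the orthogonal polar factor of `Uᵀ P₁`, which
makes it as close to `U` as possible. -/
theorem IsCompactSVD.exists_topLeftSingular_expansion (hX : IsCompactSVD X U lam V) (hm : m < D)
    (hUperp : IsOrthonormalComplement U Uperp) (W : Matrix (Fin D) (Fin N) ℝ) :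
    ∃ Ut : ℝ → Matrix (Fin D) (Fin m) ℝ,
      (∀ᶠ ε in 𝓝 (0 : ℝ), (Ut ε)ᵀ * Ut ε = 1 ∧ ∀ S : Submodule ℝ (Fin D → ℝ),
        IsTopLeftSingularSubspace m (X + ε • W) S ↔ S = colSpan (Ut ε)) ∧
      IsBigOPow (fun ε => Ut ε -
        (U + ε • (Uperp * (Uperpᵀ * W * V) * (Matrix.diagonal lam)⁻¹))) 2 := by
  have hmN : m ≤ N := le_of_transpose_mul_self_eq_one hX.right_orthonormal
  obtain ⟨l, hl0, hl⟩ : ∃ l : ℝ, 0 < l ∧ ∀ k, l ≤ lam k := by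
    rcases isEmpty_or_nonempty (Fin m) with he | hne
    · exact ⟨1, one_pos, fun k => he.elim k⟩
    · obtain ⟨k, hk⟩ := Finite.exists_min lam
      exact ⟨lam k, hX.pos k, hk⟩
  -- The threshold `(l / 2) ^ 2` separates the squared singular values as soon as
  -- `ε ^ 2 * ∑ W i j ^ 2` is below it.
  set C : ℝ := ∑ i, ∑ j, W i j ^ 2 with hC
  have hsmall : ∀ᶠ ε in 𝓝 (0 : ℝ), ε ^ 2 * C < (l / 2) ^ 2 := by
    have hcont : Tendsto (fun ε : ℝ => ε ^ 2 * C) (𝓝 0) (𝓝 (0 ^ 2 * C)) :=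
      Continuous.tendsto (by fun_prop) 0
    refine hcont.eventually_lt_const ?_
    rw [zero_pow two_ne_zero, zero_mul]
    positivity
  have hE : ∀ ε : ℝ, ∀ v, (ε • W) *ᵥ v ⬝ᵥ (ε • W) *ᵥ v ≤ ε ^ 2 * C * (v ⬝ᵥ v) := fun ε v => by
    have h := dotProduct_mulVec_self_le W v
    rw [Matrix.smul_mulVec, smul_dotProduct, dotProduct_smul, smul_eq_mul, smul_eq_mul,
      ← mul_assoc, ← pow_two, mul_assoc]
    exact mul_le_mul_of_nonneg_left h (sq_nonneg ε)
  have hgap : ∀ᶠ ε in 𝓝 (0 : ℝ), ∀ P s R, IsSVD (X + ε • W) P s R →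
      (∀ k < m, (l / 2) ^ 2 < s k ^ 2) ∧ (m < N → s m ^ 2 ≤ (l / 2) ^ 2) := by
    filter_upwards [hsmall] with ε hε P s R h
    refine ⟨fun k hk => ?_, fun hN => ?_⟩
    · have := hX.sq_le_of_isSVD_add hl0.le hl (hE ε) h ⟨k, hk⟩
      simp only at this
      nlinarith
    · exact (hX.isSVD_add_sq_le (hE ε) h hm hN).trans hε.le
  choose P s R hsvd using fun ε : ℝ => exists_isSVD (X + ε • W)
  choose A t B hpol using fun ε : ℝ => exists_isSVD (Uᵀ * leadingCols hm.le (P ε))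
  set P₁ : ℝ → Matrix (Fin D) (Fin m) ℝ := fun ε => leadingCols hm.le (P ε) with hP₁
  set R₁ : ℝ → Matrix (Fin N) (Fin m) ℝ := fun ε => leadingCols hmN (R ε) with hR₁
  set Q : ℝ → Matrix (Fin m) (Fin m) ℝ := fun ε => B ε * (A ε)ᵀ with hQ
  set S₁ : ℝ → Matrix (Fin m) (Fin m) ℝ := fun ε => Matrix.diagonal fun k => s ε k with hS₁
  -- `T ε` inverts `S₁ ε` only for small `ε`, when the leading singular values are nonzero.
  set T : ℝ → Matrix (Fin m) (Fin m) ℝ := fun ε => Matrix.diagonal fun k => (s ε k)⁻¹ with hT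
  have hP₁o : ∀ ε, (P₁ ε)ᵀ * P₁ ε = 1 := fun ε =>
    transpose_leadingCols_mul_self hm.le (hsvd ε).transpose_mul_left
  have hR₁o : ∀ ε, (R₁ ε)ᵀ * R₁ ε = 1 := fun ε =>
    transpose_leadingCols_mul_self hmN (hsvd ε).transpose_mul_right
  have hQo : ∀ ε, (Q ε)ᵀ * Q ε = 1 := fun ε => by
    simp only [hQ]
    rw [Matrix.transpose_mul, Matrix.transpose_transpose, Matrix.mul_assoc, ← Matrix.mul_assoc _ (B ε),
      (hpol ε).transpose_mul_right, Matrix.one_mul, mul_eq_one_comm.mp (hpol ε).transpose_mul_left]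
  have hpos : ∀ᶠ ε in 𝓝 (0 : ℝ), ∀ k : Fin m, l / 2 < s ε k := by
    filter_upwards [hgap] with ε hε k
    exact lt_of_pow_lt_pow_left₀ 2 ((hsvd ε).nonneg _) ((hε _ _ _ (hsvd ε)).1 k k.2)
  have hST : ∀ᶠ ε in 𝓝 (0 : ℝ), S₁ ε * T ε = 1 := by
    filter_upwards [hpos] with ε hε
    simp only [hS₁, hT]
    rw [Matrix.diagonal_mul_diagonal, ← Matrix.diagonal_one]
    congr 1
    funext k
    exact mul_inv_cancel₀ (by linarith [hε k])
  have hT0 : IsBigOPow T 0 := fun i j => by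
    refine IsBigO.of_bound (l / 2)⁻¹ (hpos.mono fun ε hε => ?_)
    simp only [hT, Matrix.diagonal_apply, pow_zero, norm_one, mul_one]
    split_ifs
    · rw [Real.norm_of_nonneg (inv_nonneg.mpr ((hsvd ε).nonneg _))]
      exact inv_anti₀ (by positivity) (hε i).le
    · rw [norm_zero]; positivity
  have hP₁0 := IsBigOPow.of_orthonormal hP₁o
  have hR₁0 := IsBigOPow.of_orthonormal hR₁o
  have hQ0 := IsBigOPow.of_orthonormal hQo
  have hAR : ∀ ε, (X + ε • W) * R₁ ε = P₁ ε * S₁ ε := fun ε => (hsvd ε).mul_leadingCols hm.le hmN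
  have hAP : ∀ ε, (X + ε • W)ᵀ * P₁ ε = R₁ ε * S₁ ε := fun ε =>
    (hsvd ε).transpose.mul_leadingCols hmN hm.le
  have hART : ∀ᶠ ε in 𝓝 (0 : ℝ), (X + ε • W) * (R₁ ε * T ε) = P₁ ε := hST.mono fun ε hε => by
    rw [← Matrix.mul_assoc, hAR, Matrix.mul_assoc, hε, Matrix.mul_one]
  have hproj := hUperp.mul_transpose_add hm.le hX.left_orthonormal
  have hperpP : IsBigOPow (fun ε => Uperpᵀ * P₁ ε) 1 := by
    refine (((hR₁0.mul hT0).const_mul W).const_mul Uperpᵀ).smul.congr' (hART.mono fun ε hε => ?_)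
    rw [← hX.perp_mul_add_smul_mul hUperp, hε]
  have hM : IsBigOPow (fun ε => 1 - (Uᵀ * P₁ ε)ᵀ * (Uᵀ * P₁ ε)) 2 := by
    refine (hperpP.transpose.mul hperpP).congr' (Eventually.of_forall fun ε => ?_)
    have h1 : (P₁ ε)ᵀ * ((U * Uᵀ + Uperp * Uperpᵀ) * P₁ ε) = 1 := by
      rw [hproj, Matrix.one_mul, hP₁o]
    rw [← h1]
    simp only [Matrix.transpose_mul, Matrix.transpose_transpose, Matrix.add_mul, Matrix.mul_add,
      Matrix.mul_assoc, add_sub_cancel_left]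
  refine ⟨fun ε => P₁ ε * Q ε, ?_, ?_⟩
  · filter_upwards [hgap] with ε hε
    refine ⟨?_, fun S => ?_⟩
    · rw [Matrix.transpose_mul, Matrix.mul_assoc, ← Matrix.mul_assoc _ (P₁ ε), hP₁o, Matrix.one_mul,
        hQo]
    · rw [colSpan_mul_of_mul_eq_one _ (mul_eq_one_comm.mp (hQo ε)),
        ← span_col_image_eq_colSpan hm.le]
      constructor
      · rintro ⟨P', s', R', h', rfl⟩
        have hg := hε _ _ _ (hsvd ε)
        have hg' := hε _ _ _ h'
        exact ((hsvd ε).span_le_span h' hmN (sq_nonneg _) hg.2 hg'.1).antisymm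
          (h'.span_le_span (hsvd ε) hmN (sq_nonneg _) hg'.2 hg.1)
      · intro hSeq
        exact ⟨P ε, s ε, R ε, hsvd ε, hSeq⟩
  · refine hX.isBigOPow_sub hm.le hUperp W (Z := fun ε => R₁ ε * T ε * Q ε)
      (G := fun ε => P₁ ε * (T ε * T ε) * Q ε) ((hR₁0.mul hT0).mul hQ0)
      ((hP₁0.mul (hT0.mul hT0)).mul hQ0) ?_ ?_ ?_
    · simpa only [Matrix.mul_assoc] using hM.one_sub_mul_polar hpol
    · filter_upwards [hART] with ε hε
      rw [← Matrix.mul_assoc, hε]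
    · filter_upwards [hST] with ε hε
      rw [← Matrix.mul_assoc _ _ (Q ε), ← Matrix.mul_assoc _ (P₁ ε), hAP, Matrix.mul_assoc (R₁ ε),
        ← Matrix.mul_assoc (S₁ ε), hε, Matrix.one_mul]

end Expansion

theorem mainTheorem4 {Ω : Type*} [MeasurableSpace Ω] (μ : Measure Ω) [IsProbabilityMeasure μ]
    (D N m : ℕ) (hm : m < D)
    (X : Matrix (Fin D) (Fin N) ℝ)
    (U : Matrix (Fin D) (Fin m) ℝ) (lam : Fin m → ℝ) (V : Matrix (Fin N) (Fin m) ℝ)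
    (hX : IsCompactSVD X U lam V)
    (Uperp : Matrix (Fin D) (Fin (D - m)) ℝ) (hUperp : IsOrthonormalComplement U Uperp)
    (W : Ω → Matrix (Fin D) (Fin N) ℝ) (hW : IsGaussianMatrix W (1 / (D : ℝ≥0)) μ) :
    ∃ W₀ : Ω → Matrix (Fin (D - m)) (Fin m) ℝ,
      IsGaussianMatrix W₀ (1 / (D : ℝ≥0)) μ ∧
      ∃ Utilde : Ω → ℝ → Matrix (Fin D) (Fin m) ℝ, ∀ ω,
        (∀ᶠ ε in 𝓝 (0 : ℝ),
          (Utilde ω ε)ᵀ * Utilde ω ε = 1 ∧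
          ∀ S : Submodule ℝ (Fin D → ℝ),
            IsTopLeftSingularSubspace m (X + ε • W ω) S ↔ S = colSpan (Utilde ω ε)) ∧
        ∀ i j,
          (fun ε : ℝ =>
            (Utilde ω ε - (U + ε • (Uperp * W₀ ω * (Matrix.diagonal lam)⁻¹))) i j)
            =O[𝓝 0] (fun ε : ℝ => ε ^ 2) := by
  choose Ut hUt using fun ω => hX.exists_topLeftSingular_expansion hm hUperp (W ω)
  exact ⟨fun ω => Uperpᵀ * W ω * V, hW.transpose_mul_mul hUperp.orthonormal hX.right_orthonormal,
    Ut, hUt⟩
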